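/- All Banach spaces are real; $B_Y$ is the closed unit ball and $S_{Y^*}$ the unit sphere of the dual. A subset $A$ of a metric space $X$ is *porous* if there are $\lambda_0\in(0,1]$ and $r_0>0$ such that for all $x\in X$ and $r\in(0,r_0]$ there is $y\in X$ with $\mathring B(y,\lambda_0 r)\subseteq \mathring B(x,r)\cap (X\setminus A)$ (open balls); it is *$\sigma$-porous* if it is a countable union of porous sets. A bounded linear operator $R:E\to F$ *attains strongly its norm on* $A\subseteq S_E$ if $\|R\|=\sup_{x\in A}\|R(x)\|$ and there is $x_0\in A$ with $\|R(x_0)\|=\sup_{x\in A}\|R(x)\|$ such that $\|x_n-x_0\|\to 0$ whenever $(x_n)\subseteq A$ and $\|R(x_n)\|\to\|R(x_0)\|$. **Corollary.** Let $Y\neq\{0\}$ be a Banach space with the following property: (i) there is a norm-closed set $B\subseteq S_{Y^*}$ such that $\|y\|=\sup_{y^*\in B}|y^*(y)|$ for all $y\in Y$; (ii) for every sufficiently small $\varepsilon>0$ there is $\varpi_Y(\varepsilon)>0$ such that for every $y^*\in B$ there is $y_{y^*,\varepsilon}\in B_Y$ with $$\forall t^*\in B:\quad \|t^*-y^*\|\ge\varepsilon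 \Longrightarrow y^*(y_{y^*,\varepsilon})-\varpi_Y(\varepsilon)\ge |t^*(y_{y^*,\varepsilon})|.$$ Let $W\neq\{0\}$ be any Banach space and let $\mathcal B$ be any closed subspace of the space $\mathcal L(W,Y)$ of bounded linear operators (with the operator norm) that contains all bounded finite-rank operators. Then for every $S\in\mathcal L(W,Y)$ the set $$\mathcal G(S)=\{T\in\mathcal B : S^*+T^*:Y^*\to W^* \text{ attains strongly its norm on } B\}$$ is the complement of a $\sigma$-porous subset of $\mathcal B$. Moreover, for every $\varepsilon>0$ there is $\eta(\varepsilon)>0$ such that whenever $T\in\mathcal B$ with $\|T\|=\|T^*\|=1$ and $y^*\in B$ satisfy $\|T^*(y^*)\|>1-\eta(\varepsilon)$, there are $S\in\mathcal B$ with $\|S\|=\|S^*\|=1$ and $t^*\in B$ such that $$\|S^*(t^*)\|=1,\qquad \|t^*-y^*\|<\varepsilon,\qquad \|S-T\|=\|S^*-T^*\|<\varepsilon.$$ -/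

import Mathlib

open Filter Topology

/-- `A` is porous in the metric space `X`: there are `lam ∈ (0, 1]` and `r₀ > 0` such that for all
`x` and all `r ∈ (0, r₀]` some open ball of radius `lam * r` lies in the open ball `B(x, r)` and
misses `A`. -/
def IsPorous {X : Type*} [MetricSpace X] (A : Set X) : Prop :=
  ∃ lam : ℝ, 0 < lam ∧ lam ≤ 1 ∧ ∃ r₀ : ℝ, 0 < r₀ ∧
    ∀ x : X, ∀ r : ℝ, 0 < r → r ≤ r₀ →
      ∃ y : X, Metric.ball y (lam * r) ⊆ Metric.ball x r ∩ Aᶜ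

/-- `A` is a countable union of porous sets (the empty set is porous, so unions indexed by `ℕ`
cover all countable unions). -/
def IsSigmaPorous {X : Type*} [MetricSpace X] (A : Set X) : Prop :=
  ∃ P : ℕ → Set X, (∀ n, IsPorous (P n)) ∧ A = ⋃ n, P n

/-- The real function `f` attains its maximum on `A` strongly at `x₀ ∈ A`: it attains its maximum
on `A` at `x₀`, and every sequence in `A` along which `f` tends to `f x₀` converges to `x₀`. -/
def AttainsStrongMaxOnAt {X : Type*} [MetricSpace X] (f : X → ℝ) (A : Set X) (x₀ : X) : Prop :=
  x₀ ∈ A ∧ (∀ x ∈ A, f x ≤ f x₀) ∧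
    ∀ u : ℕ → X, (∀ n, u n ∈ A) →
      Tendsto (fun n => f (u n)) atTop (𝓝 (f x₀)) → Tendsto u atTop (𝓝 x₀)

/-- The bounded operator `R` attains its norm strongly on the set `A` (a subset of the unit sphere
in applications): the map `x ↦ ‖R x‖` attains its maximum on `A` strongly at some point, and
`‖R‖ = sup {‖R x‖ : x ∈ A}`. -/
def AttainsNormStronglyOn {E F : Type*} [NormedAddCommGroup E] [NormedSpace ℝ E]
    [NormedAddCommGroup F] [NormedSpace ℝ F] (R : E →L[ℝ] F) (A : Set E) : Prop :=
  (∃ x₀, AttainsStrongMaxOnAt (fun x => ‖R x‖) A x₀) ∧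
    IsLUB ((fun x => ‖R x‖) '' A) ‖R‖

/-- The Banach space adjoint `T* : Y* → W*`, `T* y* = y* ∘ T`, of a bounded operator `T : W → Y`. -/
noncomputable def banachAdjoint {W Y : Type*} [NormedAddCommGroup W] [NormedSpace ℝ W]
    [NormedAddCommGroup Y] [NormedSpace ℝ Y] (T : W →L[ℝ] Y) :
    StrongDual ℝ Y →L[ℝ] StrongDual ℝ W :=
  ContinuousLinearMap.precomp ℝ T

/-- `‖y‖ = sup {|y* y| : y* ∈ B}` for all `y` (a supremum of a nonempty set of reals). -/
def IsNormingSet {Y : Type*} [NormedAddCommGroup Y] [NormedSpace ℝ Y]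
    (B : Set (StrongDual ℝ Y)) : Prop :=
  ∀ y : Y, IsLUB ((fun f : StrongDual ℝ Y => |f y|) '' B) ‖y‖

/-- For all small `ε > 0` there is `ϖ > 0` such that each `y* ∈ B` has a point `y` of the closed
unit ball of `Y` with `y* y - ϖ ≥ |t* y|` for all `t* ∈ B` at distance at least `ε` from `y*`. -/
def UniformlySeparated {Y : Type*} [NormedAddCommGroup Y] [NormedSpace ℝ Y]
    (B : Set (StrongDual ℝ Y)) : Prop :=
  ∃ ε₀ : ℝ, 0 < ε₀ ∧ ∀ ε : ℝ, 0 < ε → ε < ε₀ →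
    ∃ ϖ : ℝ, 0 < ϖ ∧ ∀ f ∈ B, ∃ y : Y, ‖y‖ ≤ 1 ∧
      ∀ t ∈ B, ε ≤ ‖t - f‖ → |t y| ≤ f y - ϖ

/-! Since `B` is norming, `‖T‖` is the supremum of `‖T* t‖` over `t ∈ B`. Let `f ∈ B` nearly
maximize `‖R* ·‖`, let `y` separate `f`, and let `x` be a unit functional aligned with `R* f`.
Adding the rank-one operator `K = x ⊗ δy` raises the value at `f` by exactly `δ f(y)`, but at points
of `B` far from `f` by at most `δ (f(y) - ϖ)`. The resulting gap, of order `δϖ`, survives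
perturbations of proportional size (`exists_perturbation`), so failure of localization at a fixed
scale is porous. Localization at all scales forces a strong maximum because `B` is complete. For the
quantitative part, Baire's theorem gives a norm-attaining operator near `T + K`; the gap puts its
maximizer near `f`, and the operator is then normalized. -/

lemma IsPorous.mono {X : Type*} [MetricSpace X] {A A' : Set X} (hA : IsPorous A) (h : A' ⊆ A) :
    IsPorous A' := by
  obtain ⟨lam, h0, h1, r₀, hr₀, H⟩ := hA
  refine ⟨lam, h0, h1, r₀, hr₀, fun x r hr hrr => ?_⟩
  obtain ⟨y, hy⟩ := H x r hr hrr
  exact ⟨y, hy.trans (Set.inter_subset_inter_right _ (Set.compl_subset_compl.2 h))⟩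

lemma IsPorous.isNowhereDense {X : Type*} [MetricSpace X] {A : Set X} (hA : IsPorous A) :
    IsNowhereDense A := by
  obtain ⟨lam, h0, h1, r₀, hr₀, H⟩ := hA
  rw [IsNowhereDense, Set.eq_empty_iff_forall_notMem]
  intro x hx
  obtain ⟨r, hr, hxr⟩ := Metric.isOpen_iff.1 isOpen_interior x hx
  obtain ⟨y, hy⟩ := H x (min r r₀) (lt_min hr hr₀) (min_le_right _ _)
  have hpos : 0 < lam * min r r₀ := mul_pos h0 (lt_min hr hr₀)
  have hyA : y ∈ closure A := interior_subset
    (hxr (Metric.ball_subset_ball (min_le_left _ _) (hy (Metric.mem_ball_self hpos)).1))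
  obtain ⟨z, hzA, hz⟩ := Metric.mem_closure_iff.1 hyA _ hpos
  exact (hy (Metric.mem_ball'.2 hz)).2 hzA

lemma IsSigmaPorous.dense_compl {X : Type*} [MetricSpace X] [CompleteSpace X] {A : Set X}
    (hA : IsSigmaPorous A) : Dense Aᶜ := by
  obtain ⟨P, hP, rfl⟩ := hA
  have : IsMeagre (⋃ n, P n) := isMeagre_iUnion fun n => (hP n).isNowhereDense.isMeagre
  exact dense_of_mem_residual this

/-- `f` is approximately maximized on `A` only near one point, up to `ε`; here `M` is the
supremum of `f` on `A`. -/
def NearMaxLocalized {X : Type*} [MetricSpace X] (f : X → ℝ) (A : Set X) (M ε : ℝ) : Prop :=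
  ∃ x, ∃ ρ : ℝ, 0 < ρ ∧ ∀ t ∈ A, M - ρ < f t → dist t x < ε

/-- Near maximizers cluster around a common centre at every scale, so maximizing sequences are
Cauchy, and all have the same limit. -/
lemma exists_attainsStrongMaxOnAt {X : Type*} [MetricSpace X] [CompleteSpace X] {f : X → ℝ}
    (hf : Continuous f) {A : Set X} (hA : IsClosed A) (hne : A.Nonempty) {M : ℝ}
    (hM : IsLUB (f '' A) M) (h : ∀ ε > 0, NearMaxLocalized f A M ε) :
    ∃ x₀, AttainsStrongMaxOnAt f A x₀ := by
  obtain ⟨v, -, -, hv, hvA⟩ := hM.exists_seq_monotone_tendsto (hne.image f)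
  choose u huA hu using hvA
  have hlim : Tendsto (fun n => f (u n)) atTop (𝓝 M) := by simpa only [hu] using hv
  have hcau : CauchySeq u := by
    rw [Metric.cauchySeq_iff]
    intro ε hε
    obtain ⟨x, ρ, hρ, H⟩ := h (ε / 2) (by positivity)
    obtain ⟨N, hN⟩ := eventually_atTop.1 (hlim.eventually (lt_mem_nhds (sub_lt_self M hρ)))
    refine ⟨N, fun m hm n hn => ?_⟩
    have h1 := H _ (huA m) (hN m hm)
    have h2 := H _ (huA n) (hN n hn)
    linarith [dist_triangle_right (u m) (u n) x]
  obtain ⟨x₀, hx₀⟩ := cauchySeq_tendsto_of_complete hcau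
  have hxA : x₀ ∈ A := hA.mem_of_tendsto hx₀ (Eventually.of_forall huA)
  have hfx : f x₀ = M := tendsto_nhds_unique ((hf.tendsto x₀).comp hx₀) hlim
  refine ⟨x₀, hxA, fun x hx => hfx ▸ hM.1 (Set.mem_image_of_mem f hx), fun w hwA hw => ?_⟩
  rw [Metric.tendsto_atTop]
  intro ε hε
  obtain ⟨x, ρ, hρ, H⟩ := h (ε / 2) (by positivity)
  rw [hfx] at hw
  obtain ⟨N, hN⟩ := eventually_atTop.1 (hw.eventually (lt_mem_nhds (sub_lt_self M hρ)))
  refine ⟨N, fun n hn => ?_⟩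
  have h1 := H _ (hwA n) (hN n hn)
  have h2 := H _ hxA (by linarith)
  linarith [dist_triangle_right (w n) x₀ x]

section Operators

variable {Y : Type*} [NormedAddCommGroup Y] [NormedSpace ℝ Y]
  {W : Type*} [NormedAddCommGroup W] [NormedSpace ℝ W] {B : Set (StrongDual ℝ Y)}

lemma banachAdjoint_add (S T : W →L[ℝ] Y) :
    banachAdjoint (S + T) = banachAdjoint S + banachAdjoint T := by
  ext f w; simp [banachAdjoint]

lemma banachAdjoint_sub (S T : W →L[ℝ] Y) :
    banachAdjoint (S - T) = banachAdjoint S - banachAdjoint T := by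
  ext f w; simp [banachAdjoint]

lemma banachAdjoint_smul (c : ℝ) (T : W →L[ℝ] Y) :
    banachAdjoint (c • T) = c • banachAdjoint T := by
  ext f w; simp [banachAdjoint]

lemma banachAdjoint_smulRight (x : StrongDual ℝ W) (y : Y) (f : StrongDual ℝ Y) :
    banachAdjoint (x.smulRight y) f = f y • x := by
  ext w; simp [banachAdjoint, mul_comm]

lemma norm_banachAdjoint_apply_le (T : W →L[ℝ] Y) (f : StrongDual ℝ Y) :
    ‖banachAdjoint T f‖ ≤ ‖f‖ * ‖T‖ :=
  f.opNorm_comp_le T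

lemma IsNormingSet.nonempty (hB : IsNormingSet B) : B.Nonempty :=
  (hB 0).nonempty.of_image

lemma IsNormingSet.isLUB_norm_adjoint (hB : IsNormingSet B)
    (hs : B ⊆ Metric.sphere (0 : StrongDual ℝ Y) 1) (T : W →L[ℝ] Y) :
    IsLUB ((fun f => ‖banachAdjoint T f‖) '' B) ‖T‖ := by
  constructor
  · rintro _ ⟨f, hf, rfl⟩
    have := norm_banachAdjoint_apply_le T f
    rwa [mem_sphere_zero_iff_norm.1 (hs hf), one_mul] at this
  · intro M hM
    obtain ⟨f₀, hf₀⟩ := hB.nonempty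
    have hM0 : 0 ≤ M := (norm_nonneg _).trans (hM (Set.mem_image_of_mem _ hf₀))
    refine T.opNorm_le_bound hM0 fun w => (hB (T w)).2 ?_
    rintro _ ⟨f, hf, rfl⟩
    calc |f (T w)| = ‖banachAdjoint T f w‖ := rfl
      _ ≤ ‖banachAdjoint T f‖ * ‖w‖ := ContinuousLinearMap.le_opNorm _ _
      _ ≤ M * ‖w‖ := by gcongr; exact hM (Set.mem_image_of_mem _ hf)

lemma IsNormingSet.norm_banachAdjoint (hB : IsNormingSet B)
    (hs : B ⊆ Metric.sphere (0 : StrongDual ℝ Y) 1) (T : W →L[ℝ] Y) :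
    ‖banachAdjoint T‖ = ‖T‖ := by
  refine le_antisymm (ContinuousLinearMap.opNorm_le_bound _ (norm_nonneg _) fun f => ?_)
    ((hB.isLUB_norm_adjoint hs T).2 ?_)
  · rw [mul_comm]; exact norm_banachAdjoint_apply_le T f
  · rintro _ ⟨f, hf, rfl⟩
    simpa [mem_sphere_zero_iff_norm.1 (hs hf)] using (banachAdjoint T).le_opNorm f

/-- Normalize `g`; if `g = 0`, any unit functional works, and one exists because `W` is nontrivial.
-/
lemma exists_norm_one_norm_add_smul [Nontrivial W] (g : StrongDual ℝ W) :
    ∃ x : StrongDual ℝ W, ‖x‖ = 1 ∧ ∀ c : ℝ, 0 ≤ c → ‖g + c • x‖ = ‖g‖ + c := by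
  by_cases hg : g = 0
  · obtain ⟨w, hw⟩ := exists_ne (0 : W)
    obtain ⟨x, hx, -⟩ := exists_dual_vector ℝ w (norm_ne_zero_iff.2 hw)
    exact ⟨x, hx, fun c hc => by simp [hg, norm_smul, hx, abs_of_nonneg hc]⟩
  · have hg' : 0 < ‖g‖ := norm_pos_iff.2 hg
    refine ⟨‖g‖⁻¹ • g, ?_, fun c hc => ?_⟩
    · rw [norm_smul, norm_inv, norm_norm, inv_mul_cancel₀ hg'.ne']
    · have : g + c • ‖g‖⁻¹ • g = (1 + c * ‖g‖⁻¹) • g := by rw [add_smul, one_smul, mul_smul]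
      rw [this, norm_smul, Real.norm_of_nonneg (by positivity)]
      field_simp

lemma finiteDimensional_range_smulRight (x : StrongDual ℝ W) (y : Y) :
    FiniteDimensional ℝ (LinearMap.range ((x.smulRight y : W →L[ℝ] Y) : W →ₗ[ℝ] Y)) := by
  refine Submodule.finiteDimensional_of_le (S₂ := Submodule.span ℝ {y}) ?_
  rintro _ ⟨w, rfl⟩
  exact Submodule.mem_span_singleton.2 ⟨x w, rfl⟩

lemma norm_adjoint_diff_le (hs : B ⊆ Metric.sphere (0 : StrongDual ℝ Y) 1) (S T : W →L[ℝ] Y)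
    {t : StrongDual ℝ Y} (ht : t ∈ B) :
    ‖banachAdjoint S t‖ ≤ ‖banachAdjoint T t‖ + ‖S - T‖ := by
  have h1 := norm_banachAdjoint_apply_le (S - T) t
  rw [mem_sphere_zero_iff_norm.1 (hs ht), one_mul, banachAdjoint_sub] at h1
  have h2 := norm_sub_norm_le (banachAdjoint S t) (banachAdjoint T t)
  simp only [_root_.sub_apply] at h1
  linarith

/-- A rank one perturbation of norm at most `δ` localizes the near maximizers of the norm of the
adjoint, for all operators close to the perturbed one. -/
lemma exists_perturbation [Nontrivial W] (hB : IsNormingSet B)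
    (hs : B ⊆ Metric.sphere (0 : StrongDual ℝ Y) 1) {ε ϖ δ : ℝ} (hδ : 0 < δ)
    (hϖ : 0 < ϖ) {f : StrongDual ℝ Y} (hf : f ∈ B) {y : Y} (hy : ‖y‖ ≤ 1)
    (hsep : ∀ t ∈ B, ε ≤ ‖t - f‖ → |t y| ≤ f y - ϖ) (R : W →L[ℝ] Y)
    (hR : ‖R‖ - δ * ϖ / 2 < ‖banachAdjoint R f‖) :
    ∃ K : W →L[ℝ] Y, FiniteDimensional ℝ (LinearMap.range (K : W →ₗ[ℝ] Y)) ∧ ‖K‖ ≤ δ ∧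
      ∀ R' : W →L[ℝ] Y, ∀ t ∈ B,
        ‖R'‖ - δ * ϖ / 2 + 2 * ‖R' - (R + K)‖ < ‖banachAdjoint R' t‖ → ‖t - f‖ < ε := by
  obtain ⟨x, hx, hxadd⟩ := exists_norm_one_norm_add_smul (banachAdjoint R f)
  have hadj : ∀ t : StrongDual ℝ Y, banachAdjoint (R + x.smulRight (δ • y)) t
      = banachAdjoint R t + (δ * t y) • x := fun t => by
    rw [banachAdjoint_add, _root_.add_apply, banachAdjoint_smulRight]; simp
  refine ⟨x.smulRight (δ • y), finiteDimensional_range_smulRight _ _, ?_, ?_⟩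
  · rw [ContinuousLinearMap.norm_smulRight_apply, hx, one_mul, norm_smul,
      Real.norm_of_nonneg hδ.le]
    exact mul_le_of_le_one_right hδ.le hy
  · intro R' t ht hR'
    by_contra! hcon
    have hty := hsep t ht hcon
    -- The sign makes `δ * f y` an admissible coefficient in `hxadd`.
    have hfy : 0 ≤ f y := by linarith [abs_nonneg (t y)]
    have h1 := norm_adjoint_diff_le hs R' (R + x.smulRight (δ • y)) ht
    have h2 := norm_adjoint_diff_le hs (R + x.smulRight (δ • y)) R' hf
    rw [norm_sub_rev] at h2
    have h3 : ‖banachAdjoint R' f‖ ≤ ‖R'‖ :=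
      (hB.isLUB_norm_adjoint hs R').1 (Set.mem_image_of_mem _ hf)
    have h4 : ‖banachAdjoint R t‖ ≤ ‖R‖ :=
      (hB.isLUB_norm_adjoint hs R).1 (Set.mem_image_of_mem _ ht)
    have h5 : ‖banachAdjoint R t + (δ * t y) • x‖ ≤ ‖banachAdjoint R t‖ + δ * |t y| := by
      refine (norm_add_le _ _).trans_eq ?_
      rw [norm_smul, hx, mul_one, Real.norm_eq_abs, abs_mul, abs_of_pos hδ]
    have h6 := mul_le_mul_of_nonneg_left hty hδ.le
    rw [hadj] at h1 h2
    rw [hxadd _ (by positivity)] at h2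
    linarith

/-- The operators in `𝓑` for which the near maximizers of the norm of the adjoint of `S + T` are
not `ε`-localized form a porous set. -/
lemma isPorous_not_nearMaxLocalized [Nontrivial W] (hB : IsNormingSet B)
    (hs : B ⊆ Metric.sphere (0 : StrongDual ℝ Y) 1) {𝓑 : Submodule ℝ (W →L[ℝ] Y)}
    (h𝓑 : ∀ T : W →L[ℝ] Y,
      FiniteDimensional ℝ (LinearMap.range (T : W →ₗ[ℝ] Y)) → T ∈ 𝓑) {ε ϖ : ℝ} (hϖ : 0 < ϖ)
    (hsep : ∀ f ∈ B, ∃ y : Y, ‖y‖ ≤ 1 ∧ ∀ t ∈ B, ε ≤ ‖t - f‖ → |t y| ≤ f y - ϖ)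
    (S : W →L[ℝ] Y) :
    IsPorous {T : 𝓑 | ¬ NearMaxLocalized (fun t => ‖banachAdjoint (S + (T : W →L[ℝ] Y)) t‖) B
      ‖S + (T : W →L[ℝ] Y)‖ ε} := by
  -- With `δ = r / 2` the gap is `rϖ/4`; a radius `ϖr/16` costs at most `rϖ/8`, leaving `rϖ/8` for
  -- `ρ`. The `1 / 2` keeps the small ball inside `B(T, r)`, as `‖K‖ ≤ r / 2`.
  refine ⟨min (ϖ / 16) (1 / 2), by positivity, (min_le_right _ _).trans (by norm_num), 1,
    one_pos, fun T r hr _ => ?_⟩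
  obtain ⟨_, ⟨f, hf, rfl⟩, hlt, -⟩ := (hB.isLUB_norm_adjoint hs (S + (T : W →L[ℝ] Y))).exists_between
    (sub_lt_self _ (show 0 < r / 2 * ϖ / 2 by positivity))
  obtain ⟨y, hy, hyt⟩ := hsep f hf
  obtain ⟨K, hK, hKn, H⟩ := exists_perturbation hB hs (half_pos hr) hϖ hf hy hyt _ hlt
  refine ⟨T + ⟨K, h𝓑 K hK⟩, fun T' hT' => ?_⟩
  have hd : dist T' (T + ⟨K, h𝓑 K hK⟩) < min (ϖ / 16) (1 / 2) * r := hT'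
  have hKd : dist (T + ⟨K, h𝓑 K hK⟩) T ≤ r / 2 := by
    rw [dist_eq_norm, add_sub_cancel_left]; exact hKn
  have hm1 : min (ϖ / 16) (1 / 2) * r ≤ ϖ / 16 * r := by gcongr; exact min_le_left _ _
  have hm2 : min (ϖ / 16) (1 / 2) * r ≤ 1 / 2 * r := by gcongr; exact min_le_right _ _
  refine ⟨?_, ?_⟩
  · rw [Metric.mem_ball]
    linarith [dist_triangle T' (T + ⟨K, h𝓑 K hK⟩) T]
  · have hd' : ‖(S + (T' : W →L[ℝ] Y)) - (S + (T : W →L[ℝ] Y) + K)‖ < ϖ / 16 * r := by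
      have h1 : (S + (T' : W →L[ℝ] Y)) - (S + (T : W →L[ℝ] Y) + K)
          = ((T' - (T + ⟨K, h𝓑 K hK⟩) : 𝓑) : W →L[ℝ] Y) := by
        push_cast; abel
      rw [h1]
      rw [dist_eq_norm] at hd
      exact hd.trans_le hm1
    refine not_not.2 ⟨f, r * ϖ / 8, by positivity, fun t ht htl => ?_⟩
    rw [dist_eq_norm]
    refine H (S + (T' : W →L[ℝ] Y)) t ht ?_
    dsimp only at htl
    linarith

lemma isSigmaPorous_not_attainsNormStronglyOn [Nontrivial W]
    (hs : B ⊆ Metric.sphere (0 : StrongDual ℝ Y) 1) (hc : IsClosed B) (hB : IsNormingSet B)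
    (hsep : UniformlySeparated B) {𝓑 : Submodule ℝ (W →L[ℝ] Y)}
    (h𝓑 : ∀ T : W →L[ℝ] Y,
      FiniteDimensional ℝ (LinearMap.range (T : W →ₗ[ℝ] Y)) → T ∈ 𝓑) (S : W →L[ℝ] Y) :
    IsSigmaPorous {T : 𝓑 | AttainsNormStronglyOn
      (banachAdjoint S + banachAdjoint (T : W →L[ℝ] Y)) B}ᶜ := by
  obtain ⟨ε₀, hε₀, hsep⟩ := hsep
  -- The shift by 2 keeps the scale strictly below `ε₀`, even at `n = 0`.
  set P : ℕ → Set 𝓑 := fun n =>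
    {T : 𝓑 | ¬ NearMaxLocalized (fun t => ‖banachAdjoint (S + (T : W →L[ℝ] Y)) t‖) B
      ‖S + (T : W →L[ℝ] Y)‖ (ε₀ / (n + 2))}
  set A : Set 𝓑 := {T : 𝓑 | AttainsNormStronglyOn
      (banachAdjoint S + banachAdjoint (T : W →L[ℝ] Y)) B}ᶜ
  have hP : ∀ n, IsPorous (P n) := fun n => by
    obtain ⟨ϖ, hϖ, h⟩ := hsep (ε₀ / (n + 2)) (by positivity)
      (div_lt_self hε₀ (by linarith [(n.cast_nonneg : (0 : ℝ) ≤ n)]))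
    exact isPorous_not_nearMaxLocalized hB hs h𝓑 hϖ h S
  have hA : A ⊆ ⋃ n, P n := by
    intro T hT
    by_contra hcon
    simp only [P, Set.mem_iUnion, Set.mem_ofPred_eq, not_exists, not_not] at hcon
    refine hT ?_
    have hlub := hB.isLUB_norm_adjoint hs (S + (T : W →L[ℝ] Y))
    rw [Set.mem_ofPred_eq, ← banachAdjoint_add]
    refine ⟨exists_attainsStrongMaxOnAt (banachAdjoint _).continuous.norm hc hB.nonempty hlub
      fun ε hε => ?_, by rwa [hB.norm_banachAdjoint hs]⟩
    obtain ⟨n, hn⟩ := exists_nat_gt (ε₀ / ε)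
    obtain ⟨x, ρ, hρ, h⟩ := hcon n
    refine ⟨x, ρ, hρ, fun t ht htl => (h t ht htl).trans ?_⟩
    rw [div_lt_iff₀ hε] at hn
    rw [div_lt_iff₀ (by positivity)]
    linarith
  -- σ-porosity asks for equality with a union, hence the intersection with `A`.
  refine ⟨fun n => P n ∩ A, fun n => (hP n).mono Set.inter_subset_left, ?_⟩
  rw [← Set.iUnion_inter, Set.inter_eq_right.2 hA]

end Operators

theorem corollary3p15
    {Y : Type*} [NormedAddCommGroup Y] [NormedSpace ℝ Y] [CompleteSpace Y] [Nontrivial Y]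
    (B : Set (StrongDual ℝ Y))
    (hB_sphere : B ⊆ Metric.sphere (0 : StrongDual ℝ Y) 1)
    (hB_closed : IsClosed B)
    (hB_norming : IsNormingSet B)
    (hB_sep : UniformlySeparated B)
    {W : Type*} [NormedAddCommGroup W] [NormedSpace ℝ W] [CompleteSpace W] [Nontrivial W]
    (𝓑 : Submodule ℝ (W →L[ℝ] Y))
    (h𝓑_closed : IsClosed (𝓑 : Set (W →L[ℝ] Y)))
    (h𝓑_finiteRank : ∀ T : W →L[ℝ] Y,
      FiniteDimensional ℝ (LinearMap.range (T : W →ₗ[ℝ] Y)) → T ∈ 𝓑) :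
    (∀ S : W →L[ℝ] Y,
      IsSigmaPorous
        {T : 𝓑 | AttainsNormStronglyOn
          (banachAdjoint S + banachAdjoint (T : W →L[ℝ] Y)) B}ᶜ) ∧
    (∀ ε : ℝ, 0 < ε → ∃ η : ℝ, 0 < η ∧
      ∀ T ∈ 𝓑, ‖T‖ = 1 → ∀ y' ∈ B, 1 - η < ‖banachAdjoint T y'‖ →
        ∃ S ∈ 𝓑, ‖S‖ = 1 ∧ ‖banachAdjoint S‖ = 1 ∧
          ∃ t' ∈ B, ‖banachAdjoint S t'‖ = 1 ∧ ‖t' - y'‖ < ε ∧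
            ‖S - T‖ < ε ∧ ‖banachAdjoint S - banachAdjoint T‖ = ‖S - T‖) := by
  refine ⟨fun S => isSigmaPorous_not_attainsNormStronglyOn hB_sphere hB_closed hB_norming hB_sep
    h𝓑_finiteRank S, fun ε hε => ?_⟩
  obtain ⟨ε₀, hε₀, hsep⟩ := id hB_sep
  obtain ⟨ϖ, hϖ, hsep⟩ := hsep (min ε ε₀ / 2) (by positivity)
    (by linarith [min_le_right ε ε₀, lt_min hε hε₀])
  -- `R` will lie within `2δ` of `T`, and normalizing moves it by less than another `2δ`; the bound
  -- by 1 keeps `‖R‖` positive.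
  set δ : ℝ := min ε 1 / 8
  have hδ : 0 < δ := by positivity
  have hδε : 8 * δ ≤ ε := by simp only [δ]; linarith [min_le_left ε 1]
  have hδ1 : 8 * δ ≤ 1 := by simp only [δ]; linarith [min_le_right ε 1]
  refine ⟨δ * ϖ / 2, by positivity, fun T hT hT1 f hf hTf => ?_⟩
  obtain ⟨y, hy, hyt⟩ := hsep f hf
  obtain ⟨K, hK, hKn, H⟩ := exists_perturbation hB_norming hB_sphere hδ hϖ hf hy hyt T
    (by rwa [hT1])
  have hKB := h𝓑_finiteRank K hK
  have : CompleteSpace 𝓑 := h𝓑_closed.completeSpace_coe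
  -- Radius `δϖ/8` costs at most `δϖ/4` of the gap `δϖ/2`, so `H` applies to the maximizer of `R*`.
  obtain ⟨R, hR, hRd⟩ := (isSigmaPorous_not_attainsNormStronglyOn hB_sphere hB_closed hB_norming
    hB_sep h𝓑_finiteRank (0 : W →L[ℝ] Y)).dense_compl.exists_dist_lt
      (⟨T + K, 𝓑.add_mem hT hKB⟩ : 𝓑) (show 0 < min δ (δ * ϖ / 8) by positivity)
  rw [compl_compl, Set.mem_ofPred_eq, ← banachAdjoint_add, zero_add] at hR
  obtain ⟨⟨t, ht, htmax, -⟩, hlub⟩ := hR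
  have hnorm : ‖banachAdjoint (R : W →L[ℝ] Y) t‖ = ‖(R : W →L[ℝ] Y)‖ := by
    rw [← hB_norming.norm_banachAdjoint hB_sphere (R : W →L[ℝ] Y)]
    refine le_antisymm (hlub.1 (Set.mem_image_of_mem _ ht)) (hlub.2 ?_)
    rintro _ ⟨s, hs, rfl⟩
    exact htmax s hs
  rw [dist_comm, dist_eq_norm] at hRd
  have hRd' : ‖(R : W →L[ℝ] Y) - (T + K)‖ < min δ (δ * ϖ / 8) := hRd
  have hR1 : ‖(R : W →L[ℝ] Y) - (T + K)‖ < δ := hRd'.trans_le (min_le_left _ _)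
  have hR2 : ‖(R : W →L[ℝ] Y) - (T + K)‖ < δ * ϖ / 8 := hRd'.trans_le (min_le_right _ _)
  have htf : ‖t - f‖ < min ε ε₀ / 2 := H R t ht (by
    rw [hnorm]; linarith [mul_pos hδ hϖ])
  have hRT : ‖(R : W →L[ℝ] Y) - T‖ < 2 * δ := by
    have : (R : W →L[ℝ] Y) - T = (R - (T + K)) + K := by abel
    rw [this]
    linarith [norm_add_le ((R : W →L[ℝ] Y) - (T + K)) K]
  have habs := (abs_norm_sub_norm_le (R : W →L[ℝ] Y) T).trans_lt hRT
  rw [hT1] at habs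
  have hRpos : 0 < ‖(R : W →L[ℝ] Y)‖ := by linarith [(abs_lt.1 habs).1]
  set c : ℝ := ‖(R : W →L[ℝ] Y)‖⁻¹
  have hc : 0 < c := inv_pos.2 hRpos
  have hcR : c * ‖(R : W →L[ℝ] Y)‖ = 1 := inv_mul_cancel₀ hRpos.ne'
  have hS1 : ‖c • (R : W →L[ℝ] Y)‖ = 1 := by rw [norm_smul, Real.norm_of_nonneg hc.le, hcR]
  have hSR : ‖c • (R : W →L[ℝ] Y) - R‖ < 2 * δ := by
    have : c • (R : W →L[ℝ] Y) - R = (c - 1) • (R : W →L[ℝ] Y) := by rw [sub_smul, one_smul]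
    rw [this, norm_smul, Real.norm_eq_abs, ← abs_of_pos hRpos, ← abs_mul, sub_mul, one_mul,
      hcR, abs_sub_comm]
    exact habs
  refine ⟨c • (R : W →L[ℝ] Y), 𝓑.smul_mem c R.2, hS1, ?_, t, ht, ?_, ?_, ?_, ?_⟩
  · rw [hB_norming.norm_banachAdjoint hB_sphere, hS1]
  · rw [banachAdjoint_smul, _root_.smul_apply, norm_smul,
      Real.norm_of_nonneg hc.le, hnorm, hcR]
  · linarith [min_le_left ε ε₀]
  · linarith [norm_sub_le_norm_sub_add_norm_sub (c • (R : W →L[ℝ] Y)) R T]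
  · rw [← banachAdjoint_sub, hB_norming.norm_banachAdjoint hB_sphere]
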